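/- **Model.** A radio network is a finite simple connected graph $G=(V,E)$; its size is $|V|$ and $\Delta$ is its maximum degree. A labeling of $G$ is any function from $V$ to the finite binary strings (labels need not be distinct); its length is the maximum length of a label. A labeling scheme chooses a labeling for every network. A deterministic algorithm is run by all nodes, which start in the same round and work in synchronous rounds. Initially a node knows only its label; in each round it either transmits a message (a finite binary string) to all its neighbors or listens, the choice being an arbitrary function of its label and of what it has heard so far. A node hears a message in a round if and only if it listens in this round and exactly one of its neighbors transmits; otherwise it hears nothing, and it cannot distinguish a collision from silence. At the beginning or after any round a node may irrevocably output a number, determined by its label and by what it has heard so far. The algorithm solves size discovery on $G$, with a given labeling, if every node of $G$ outputs $|V|$. For an algorithm $\mathcal A$ with a labeling scheme $\mathcal L$, let $T_{\mathcal A,\mathcal L}(n)$ be the maximum, over all networks of size at most $n$, of the number of rounds after which all nodes have produced their output. Logarithms are to base 2. **Theorem.** There is a constant $c>0$ such that the following hold. 1. There is $N$ such that for every $n\ge N$, every algorithm $\mathcal A$ and every labeling scheme $\mathcal L$: if the labelings given by $\mathcal L$ to the networks of size at most $n$ have length smaller than $\frac14\log n$, and $\mathcal A$ with $\mathcal L$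 solves size discovery on all networks of size at most $n$, then $T_{\mathcal A,\mathcal L}(n)\ge c\log^2 n$. 2. Consequently, $\Omega(\log^2 n)$ is a lower bound on the time of all algorithms that use labeling schemes of the (optimal) length $O(\log\log\Delta)$: for every $C$ there is $N$ such that, whenever an algorithm $\mathcal A$ with a labeling scheme $\mathcal L$ solves size discovery on all networks and $\mathcal L$ gives every network of maximum degree $\Delta$ a labeling of length at most $C\,(1+\log\log(\Delta+2))$, we have $T_{\mathcal A,\mathcal L}(n)\ge c\log^2 n$ for all $n\ge N$. -/

import Mathlib

namespace RadioNetwork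

/-- Binary strings, used both as labels and as messages. -/
abbrev BinString : Type := List Bool

/-- What a node has heard in the consecutive rounds so far: `some m` if it received the
message `m` in that round, and `none` otherwise. There is no collision detection: silence,
a collision at the node, and a round in which the node itself transmits are all recorded
as `none`. -/
abbrev History : Type := List (Option BinString)

/-- A deterministic distributed algorithm. All nodes run the same algorithm, and the only
initial knowledge of a node is its label. A node's behaviour is thus an arbitrary function of
its label and of its history; the number of elapsed rounds is the length of the history, and
its own past transmissions are determined by these data. -/
structure Algorithm where
  /-- The action in the next round: `some m` means "transmit `m`", `none` means "listen". -/
  action : BinString → History → Option BinString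
  /-- The output after the rounds of the history: `some x` means "output `x`", `none` means
  that there is no output yet. -/
  output : BinString → History → Option ℕ

/-- Reception in one round of the radio model on the graph `G`, where `act w` is the action of
the node `w`: the node `v` receives a message iff it listens and exactly one of its neighbours
transmits, and the message is then the one transmitted by that neighbour. -/
noncomputable def heard {V : Type*} (G : SimpleGraph V) (act : V → Option BinString) (v : V) :
    Option BinString :=
  open Classical in
  if h : act v = none ∧ ∃! w, G.Adj v w ∧ act w ≠ none then act h.2.choose else none

/-- The history of every node after `t` rounds of the execution of `A` on the network `G`
with node labels `lab`. All nodes start in the same round. -/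
noncomputable def history {V : Type*} (A : Algorithm) (G : SimpleGraph V)
    (lab : V → BinString) : ℕ → V → History
  | 0, _ => []
  | t + 1, v =>
      history A G lab t v ++
        [heard G (fun w => A.action (lab w) (history A G lab t w)) v]

/-- The node `v` outputs the number `x` at the end of round `t`, not having output anything
before (an output is irrevocable, so only the first one counts). -/
def OutputsAt {V : Type*} (A : Algorithm) (G : SimpleGraph V) (lab : V → BinString)
    (v : V) (t : ℕ) (x : ℕ) : Prop :=
  A.output (lab v) (history A G lab t v) = some x ∧
    ∀ s < t, A.output (lab v) (history A G lab s v) = none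

/-- `A` solves size discovery on the network `G` with labels `lab`: every node eventually
outputs the number of nodes of `G`. -/
def SolvesSizeDiscovery {V : Type*} [Fintype V] (A : Algorithm) (G : SimpleGraph V)
    (lab : V → BinString) : Prop :=
  ∀ v, ∃ t, OutputsAt A G lab v t (Fintype.card V)

/-- All nodes have produced their output within the first `T` rounds. -/
def FinishedBy {V : Type*} (A : Algorithm) (G : SimpleGraph V) (lab : V → BinString)
    (T : ℕ) : Prop :=
  ∀ v, ∃ t ≤ T, ∃ x, OutputsAt A G lab v t x

/-- The number of rounds of the execution of `A` on `G` with labels `lab`, that is, the least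
`T` such that all nodes have produced their output within the first `T` rounds
(`⊤` if there is none). -/
noncomputable def runningTime {V : Type*} (A : Algorithm) (G : SimpleGraph V)
    (lab : V → BinString) : ℕ∞ :=
  ⨅ (T : ℕ) (_ : FinishedBy A G lab T), (T : ℕ∞)

/-- A choice of a labeling, that is, of an arbitrary function from the nodes to the binary
strings, for every finite graph (with nodes numbered `0, …, k - 1`; the numbers are not known
to the nodes). -/
abbrev LabelingScheme : Type := (k : ℕ) → SimpleGraph (Fin k) → Fin k → BinString

/-- The length of a labeling: the maximum length of a label assigned by it. -/
def labelingLength {V : Type*} [Fintype V] (lab : V → BinString) : ℕ :=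
  Finset.univ.sup fun v => (lab v).length

/-- `A`, using the labeling scheme `L`, solves size discovery on all networks (connected
graphs) of size at most `n`. -/
def SolvesUpTo (A : Algorithm) (L : LabelingScheme) (n : ℕ) : Prop :=
  ∀ k ≤ n, ∀ G : SimpleGraph (Fin k), G.Connected → SolvesSizeDiscovery A G (L k G)

/-- The time complexity of `A` with the labeling scheme `L`: the worst-case number of rounds
over all networks (connected graphs) of size at most `n`. -/
noncomputable def timeComplexity (A : Algorithm) (L : LabelingScheme) (n : ℕ) : ℕ∞ :=
  ⨆ (k : ℕ) (_ : k ≤ n) (G : SimpleGraph (Fin k)) (_ : G.Connected), runningTime A G (L k G)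

/-- The maximum degree of a finite graph. -/
noncomputable def maxDeg {V : Type*} [Fintype V] (G : SimpleGraph V) : ℕ :=
  open Classical in G.maxDegree

end RadioNetwork

/-!
The lower bound rests on a family of small two-layer networks on which every schedule of
transmissions leaves some node uninformed for `Ω(log² n)` rounds, as in the theorem of Alon,
Bar-Noy, Linial and Peleg on radio broadcast.

**From silence to time.** Such a network (`twoLayerGraph`) consists of a clique and of a second
layer, whose nodes are adjacent only to the clique nodes of a prescribed nonempty set `F j`. A node
of the second layer hears a message only if exactly one element of `F j` transmits. If the family
`F` is such that for all sets `S t` of transmitters, `t < T`, some `F j` meets no `S t` in exactly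
one element, then, for any algorithm and any labels, some node hears nothing for `T` rounds
(`exists_silent_node`). The second layer can be enlarged freely, so this happens for at least `n / 2`
network sizes up to `n`. If all these networks finished within `T` rounds, the size of each would be
the output of a node with an empty history, and so would be determined by a label; but there are
fewer than `2 n ^ (1 / 4)` labels of length below `log n / 4` (`le_timeComplexity`). Labels of
length `O(log log Δ)` are eventually this short, which gives the second part.

**The family.** Let `l` be of order `log n`, let the clique have `8 ^ l` nodes, and let
`T = ⌊l ^ 2 / 64⌋`. It suffices to find a probability distribution on sets `N` for which every
schedule `S` has probability at least `4 ^ (-l)` that `N` is nonempty and meets no `S t` exactly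
once: the number of schedules is `2 ^ (8 ^ l * T)`, and choosing sets greedily shows that `128 ^ l`
of them are good for all schedules (`exists_greedy_cover`,
`exists_family_defeating_schedules`). The distribution takes a random scale
`1 ≤ i ≤ l` and puts each node into `N` with probability `2 ^ (-i)`.

For a fixed schedule, the sets `S t` are absorbed gradually as `i` grows: at stage `i` those sets
are absorbed which add only about `2 ^ i` elements to the union `U` of the absorbed sets
(`exists_absorbing_chain`). A good event at scale `i` is that `N` avoids `U` and meets every
non-absorbed set at least twice. The first condition has probability about `exp (-2 ^ (-i) #U)`.
The others are increasing events outside `U`, hence positively correlated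
(`prod_le_sum_bernoulliWeight`), and the one for `S t` has probability at least
`exp (-O(2 ^ i / #(S t \ U)))`. The ratio `2 ^ i / #(S t \ U)` at least doubles with `i` and stays
below one until `S t` is absorbed, so its sum over the scales is bounded; so is the sum of the
contributions of each set to `2 ^ (-i) #U`. The total exponent over all `l` scales is therefore
`O(T)`, and some scale has exponent `O(T / l)`, a small multiple of `l` (`exists_scale`).
-/

namespace RadioNetwork
open Finset

/-! ### Positive correlation for random subsets -/

/-- The probability of the set `N` when every element of `s` is taken independently with
probability `p`. -/
noncomputable def bernoulliWeight {V : Type*} [DecidableEq V] (p : ℝ) (s N : Finset V) : ℝ :=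
  p ^ #N * (1 - p) ^ #(s \ N)

lemma bernoulliWeight_nonneg {V : Type*} [DecidableEq V] {p : ℝ} (hp₀ : 0 ≤ p) (hp₁ : p ≤ 1)
    (s N : Finset V) : 0 ≤ bernoulliWeight p s N :=
  mul_nonneg (pow_nonneg hp₀ _) (pow_nonneg (sub_nonneg.2 hp₁) _)

lemma sum_bernoulliWeight {V : Type*} [DecidableEq V] (p : ℝ) (s : Finset V) :
    ∑ N ∈ s.powerset, bernoulliWeight p s N = 1 := by
  have h := Finset.sum_pow_mul_eq_add_pow p (1 - p) s
  rw [add_sub_cancel, one_pow] at h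
  rw [← h]
  refine Finset.sum_congr rfl fun N hN => ?_
  rw [bernoulliWeight, card_sdiff_of_subset (mem_powerset.1 hN)]

lemma prod_one_sub_mul_le {κ : Type*} {p : ℝ} (hp₀ : 0 ≤ p) (hp₁ : p ≤ 1) (J : Finset κ)
    (b : κ → ℝ) (hb₀ : ∀ j ∈ J, 0 ≤ b j) (hb₁ : ∀ j ∈ J, b j ≤ 1) :
    ∏ j ∈ J, (1 - (1 - p) * b j) ≤ p + (1 - p) * ∏ j ∈ J, (1 - b j) := by
  classical
  induction J using Finset.induction_on with
  | empty => simp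
  | insert a J ha ih =>
    rw [prod_insert ha, prod_insert ha]
    have ih := ih (fun j hj => hb₀ j (mem_insert_of_mem hj))
      (fun j hj => hb₁ j (mem_insert_of_mem hj))
    have h0 := hb₀ a (mem_insert_self _ _)
    have h1 := hb₁ a (mem_insert_self _ _)
    have hx1 : ∏ j ∈ J, (1 - b j) ≤ 1 :=
      prod_le_one (fun j hj => sub_nonneg.2 (hb₁ j (mem_insert_of_mem hj)))
        (fun j hj => sub_le_self _ (hb₀ j (mem_insert_of_mem hj)))
    set x := ∏ j ∈ J, (1 - b j)
    have hq : 0 ≤ 1 - p := sub_nonneg.2 hp₁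
    have h2 : 0 ≤ 1 - (1 - p) * b a := by nlinarith
    calc (1 - (1 - p) * b a) * ∏ j ∈ J, (1 - (1 - p) * b j)
        ≤ (1 - (1 - p) * b a) * (p + (1 - p) * x) := mul_le_mul_of_nonneg_left ih h2
      _ ≤ p + (1 - p) * ((1 - b a) * x) := by
        have : 0 ≤ ((1 - p) * b a) * (p * (1 - x)) :=
          mul_nonneg (mul_nonneg hq h0) (mul_nonneg hp₀ (sub_nonneg.2 hx1))
        nlinarith

/-- The events "`N` meets `A j`" are positively correlated: for a random subset `N` of `s`, the
probability that all of them occur is at least the product of their probabilities. The proof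
exposes the elements of `s` one by one. -/
lemma prod_le_sum_bernoulliWeight {V κ : Type*} [DecidableEq V] [DecidableEq κ] {p : ℝ}
    (hp₀ : 0 ≤ p) (hp₁ : p ≤ 1) (s : Finset V) (J : Finset κ) (A : κ → Finset V)
    (hA : ∀ j ∈ J, A j ⊆ s) :
    ∏ j ∈ J, (1 - (1 - p) ^ #(A j)) ≤
      ∑ N ∈ s.powerset, if ∀ j ∈ J, (N ∩ A j).Nonempty then bernoulliWeight p s N else 0 := by
  have hq : 0 ≤ 1 - p := sub_nonneg.2 hp₁
  have hq1 : 1 - p ≤ 1 := sub_le_self _ hp₀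
  induction s using Finset.induction_on generalizing J A with
  | empty =>
    rcases J.eq_empty_or_nonempty with rfl | ⟨j, hj⟩
    · simp [bernoulliWeight]
    · rw [prod_eq_zero hj (by simp [subset_empty.1 (hA j hj)])]
      exact sum_nonneg fun N _ => by
        split_ifs
        exacts [bernoulliWeight_nonneg hp₀ hp₁ _ _, le_rfl]
  | insert v s hv ih =>
    rw [sum_powerset_insert hv]
    have e1 : ∑ N ∈ s.powerset, (if ∀ j ∈ J, (N ∩ A j).Nonempty then
          bernoulliWeight p (insert v s) N else 0) =
        (1 - p) * ∑ N ∈ s.powerset, (if ∀ j ∈ J, (N ∩ (A j).erase v).Nonempty then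
          bernoulliWeight p s N else 0) := by
      rw [mul_sum]
      refine sum_congr rfl fun N hN => ?_
      have hvN : v ∉ N := fun h => hv (mem_powerset.1 hN h)
      have : ∀ j, N ∩ (A j).erase v = N ∩ A j := fun j => by
        ext x; simp only [mem_inter, mem_erase]
        exact ⟨fun h => ⟨h.1, h.2.2⟩, fun h => ⟨h.1, fun e => hvN (e ▸ h.1), h.2⟩⟩
      simp only [this, mul_ite, mul_zero]
      congr 1
      rw [bernoulliWeight, bernoulliWeight, insert_sdiff_of_notMem _ hvN,
        card_insert_of_notMem (fun h => hv (mem_sdiff.1 h).1), pow_succ]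
      ring
    have e2 : ∑ N ∈ s.powerset, (if ∀ j ∈ J, (insert v N ∩ A j).Nonempty then
          bernoulliWeight p (insert v s) (insert v N) else 0) =
        p * ∑ N ∈ s.powerset, (if ∀ j ∈ J.filter (v ∉ A ·), (N ∩ A j).Nonempty then
          bernoulliWeight p s N else 0) := by
      rw [mul_sum]
      refine sum_congr rfl fun N hN => ?_
      have hvN : v ∉ N := fun h => hv (mem_powerset.1 hN h)
      have : (∀ j ∈ J, (insert v N ∩ A j).Nonempty) ↔
          ∀ j ∈ J.filter (v ∉ A ·), (N ∩ A j).Nonempty := by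
        refine ⟨fun h j hj => ?_, fun h j hj => ?_⟩
        · have := h j (mem_filter.1 hj).1
          rwa [insert_inter_of_notMem (mem_filter.1 hj).2] at this
        · by_cases hvj : v ∈ A j
          · exact ⟨v, mem_inter.2 ⟨mem_insert_self _ _, hvj⟩⟩
          · rw [insert_inter_of_notMem hvj]
            exact h j (mem_filter.2 ⟨hj, hvj⟩)
      simp only [this, mul_ite, mul_zero]
      congr 1
      have hs : insert v s \ insert v N = s \ N := by
        ext x; simp only [mem_sdiff, mem_insert, not_or]
        exact ⟨fun h => ⟨h.1.resolve_left h.2.1, h.2.2⟩,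
          fun h => ⟨Or.inr h.1, fun e => hv (e ▸ h.1), h.2⟩⟩
      rw [bernoulliWeight, bernoulliWeight, hs, card_insert_of_notMem hvN, pow_succ]
      ring
    rw [e1, e2]
    have i1 := ih J (fun j => (A j).erase v) fun j hj x hx => by
      have := hA j hj (mem_of_mem_erase hx)
      exact (mem_insert.1 this).resolve_left (ne_of_mem_erase hx)
    have i2 := ih (J.filter fun j => v ∉ A j) A fun j hj x hx => by
      have := hA j (mem_filter.1 hj).1 hx
      exact (mem_insert.1 this).resolve_left fun e => (mem_filter.1 hj).2 (e ▸ hx)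
    refine le_trans ?_ (add_le_add (mul_le_mul_of_nonneg_left i1 hq)
      (mul_le_mul_of_nonneg_left i2 hp₀))
    rw [← prod_filter_mul_prod_filter_not J (fun j => v ∉ A j)
        (fun j => 1 - (1 - p) ^ #(A j)),
      ← prod_filter_mul_prod_filter_not J (fun j => v ∉ A j)
        (fun j => 1 - (1 - p) ^ #((A j).erase v))]
    have c1 : ∏ j ∈ J with v ∉ A j, (1 - (1 - p) ^ #((A j).erase v)) =
        ∏ j ∈ J with v ∉ A j, (1 - (1 - p) ^ #(A j)) :=
      prod_congr rfl fun j hj => by rw [erase_eq_of_notMem (mem_filter.1 hj).2]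
    have c2 : ∏ j ∈ J with ¬ v ∉ A j, (1 - (1 - p) ^ #(A j)) =
        ∏ j ∈ J with ¬ v ∉ A j, (1 - (1 - p) * (1 - p) ^ #((A j).erase v)) :=
      prod_congr rfl fun j hj => by
        rw [← pow_succ', card_erase_add_one (not_not.1 (mem_filter.1 hj).2)]
    rw [c1, c2]
    have hP : 0 ≤ ∏ j ∈ J with v ∉ A j, (1 - (1 - p) ^ #(A j)) :=
      prod_nonneg fun j _ => sub_nonneg.2 (pow_le_one₀ hq hq1)
    have := prod_one_sub_mul_le hp₀ hp₁ (J.filter fun j => ¬ v ∉ A j)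
      (fun j => (1 - p) ^ #((A j).erase v)) (fun j _ => pow_nonneg hq _)
      (fun j _ => pow_le_one₀ hq hq1)
    nlinarith [mul_le_mul_of_nonneg_left this hP]

/-! ### Absorption of sets at increasing scales -/

lemma exists_absorbing_superset {ι V : Type*} [Fintype ι] [DecidableEq ι] [DecidableEq V]
    (S : ι → Finset V) (q : ℕ) (B : Finset ι) :
    ∃ B', B ⊆ B' ∧ #(B'.biUnion S) + q * #B ≤ #(B.biUnion S) + q * #B' ∧
      ∀ t ∉ B', q < #(S t \ B'.biUnion S) := by
  obtain ⟨B', hB', hmax⟩ := (univ.filter fun B' : Finset ι => B ⊆ B' ∧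
      #(B'.biUnion S) + q * #B ≤ #(B.biUnion S) + q * #B').exists_max_image card
    ⟨B, by simp⟩
  rw [mem_filter] at hB'
  refine ⟨B', hB'.2.1, hB'.2.2, fun t ht => ?_⟩
  by_contra! hle
  have h := hmax (insert t B') (mem_filter.2 ⟨mem_univ _,
    hB'.2.1.trans (subset_insert _ _), ?_⟩)
  · rw [card_insert_of_notMem ht] at h
    omega
  · rw [biUnion_insert, card_insert_of_notMem ht, union_comm, ← union_sdiff_self_eq_union]
    have := card_union_le (B'.biUnion S) (S t \ B'.biUnion S)
    have := hB'.2.2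
    rw [mul_add]
    omega

/-- For growing `i`, more and more of the sets `S t` are absorbed, in such a way that absorbing
a set at stage `i` enlarges the union of the absorbed sets by at most `2 ^ i` on average, while
a set not absorbed at stage `i` keeps more than `2 ^ i` elements outside this union. -/
lemma exists_absorbing_chain {ι V : Type*} [Fintype ι] [DecidableEq ι] [DecidableEq V]
    (S : ι → Finset V) :
    ∃ B : ℕ → Finset ι, B 0 = ∅ ∧ ∀ i, B i ⊆ B (i + 1) ∧
      #((B (i + 1)).biUnion S) + 2 ^ (i + 1) * #(B i) ≤
        #((B i).biUnion S) + 2 ^ (i + 1) * #(B (i + 1)) ∧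
      ∀ t ∉ B (i + 1), 2 ^ (i + 1) < #(S t \ (B (i + 1)).biUnion S) := by
  choose f hf using exists_absorbing_superset S
  exact ⟨fun i => Nat.rec ∅ (fun i B => f (2 ^ (i + 1)) B) i, rfl, fun i => hf _ _⟩

/-- There is a scale `i` at which the union `U` of the absorbed sets is small compared with
`2 ^ i`, and the other sets are on average large outside `U`. Over all scales, the total cost of
each set is bounded by geometric series, so some scale has a cost at most the average. -/
lemma exists_scale {ι V : Type*} [Fintype ι] [DecidableEq ι] [DecidableEq V]
    (S : ι → Finset V) {l : ℕ} (hl : 0 < l) :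
    ∃ i ∈ range l, ∃ (U : Finset V) (B : Finset ι), (∀ t ∈ B, S t ⊆ U) ∧
      (∀ t ∉ B, 2 ^ (i + 1) < #(S t \ U)) ∧ #U ≤ 2 * Fintype.card ι * 2 ^ (i + 1) ∧
      2 * ((#U : ℝ) / 2 ^ (i + 1)) + ∑ t ∈ Bᶜ, 6 * ((2 : ℝ) ^ (i + 1) / #(S t \ U)) ≤
        16 * Fintype.card ι / l := by
  obtain ⟨B, hB0, hB⟩ := exists_absorbing_chain S
  set U : ℕ → Finset V := fun i => (B i).biUnion S with hU
  set z : ℕ → ℝ := fun i => (#(U i) : ℝ) / 2 ^ i with hz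
  have hz0 : ∀ i, 0 ≤ z i := fun i => by positivity
  have hzs : ∀ k, ∑ i ∈ range k, z (i + 1) + z k ≤ 2 * #(B k) := by
    intro k
    induction k with
    | zero => simp [hz, hU, hB0]
    | succ k ih =>
      rw [sum_range_succ]
      have h : (#(U (k + 1)) : ℝ) + 2 ^ (k + 1) * #(B k) ≤
          #(U k) + 2 ^ (k + 1) * #(B (k + 1)) := by exact_mod_cast (hB k).2.1
      have h2 : 2 * z (k + 1) ≤ z k + 2 * (#(B (k + 1)) - #(B k)) := by
        have e1 : (#(U (k + 1)) : ℝ) = z (k + 1) * 2 ^ (k + 1) :=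
          (div_mul_cancel₀ _ (by positivity)).symm
        have e2 : (#(U k) : ℝ) = z k * 2 ^ k := (div_mul_cancel₀ _ (by positivity)).symm
        rw [e1, e2] at h
        have h3 : (0 : ℝ) < 2 ^ k := by positivity
        rw [pow_succ] at h
        refine le_of_mul_le_mul_right ?_ h3
        linarith
      linarith
  have hcard : ∀ k, (#(B k) : ℝ) ≤ Fintype.card ι := fun k => by
    exact_mod_cast card_le_univ (B k)
  -- The cost of the set `S t` at scale `i`; it at least doubles from one scale to the next
  -- until the set is absorbed.
  set r : ℕ → ι → ℝ := fun i t =>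
    if t ∈ B i then 0 else (2 : ℝ) ^ i / #(S t \ U i) with hr
  have hrs : ∀ t k, ∑ i ∈ range k, r (i + 1) t ≤ 2 ∧
      (t ∉ B (k + 1) → ∑ i ∈ range k, r (i + 1) t ≤ r (k + 1) t) := by
    intro t k
    induction k with
    | zero =>
      refine ⟨by simp, fun h => ?_⟩
      simp only [hr, if_neg h]
      simp only [range_zero, sum_empty]
      positivity
    | succ k ih =>
      rw [sum_range_succ]
      by_cases ht : t ∈ B (k + 1)
      · have : r (k + 1) t = 0 := by simp [hr, ht]
        rw [this, add_zero]
        exact ⟨ih.1, fun h => absurd ((hB (k + 1)).1 ht) h⟩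
      · have h1 := ih.2 ht
        have hlt : (2 : ℝ) ^ (k + 1) < #(S t \ U (k + 1)) := by
          exact_mod_cast (hB k).2.2 t ht
        have h2 : r (k + 1) t ≤ 1 := by
          simp only [hr, if_neg ht]
          exact (div_le_one (lt_trans (by positivity) hlt)).2 hlt.le
        refine ⟨by linarith, fun h => ?_⟩
        have hlt' : (2 : ℝ) ^ (k + 2) < #(S t \ U (k + 2)) := by
          exact_mod_cast (hB (k + 1)).2.2 t h
        have h3 : 2 * r (k + 1) t ≤ r (k + 1 + 1) t := by
          simp only [hr, if_neg ht, if_neg h]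
          have hsub : (#(S t \ U (k + 2)) : ℝ) ≤ #(S t \ U (k + 1)) := by
            exact_mod_cast card_le_card
              (sdiff_subset_sdiff le_rfl (biUnion_subset_biUnion_of_subset_left _ (hB _).1))
          rw [← mul_div_assoc, ← pow_succ']
          exact div_le_div_of_nonneg_left (by positivity) (lt_trans (by positivity) hlt') hsub
        linarith
  have htot : ∑ i ∈ range l, (2 * z (i + 1) + ∑ t, 6 * r (i + 1) t) ≤
      ∑ i ∈ range l, (16 * Fintype.card ι / l : ℝ) := by
    rw [sum_const, card_range, nsmul_eq_mul, mul_div_cancel₀ _ (by positivity),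
      sum_add_distrib, ← mul_sum, sum_comm]
    have h1 : ∑ t, ∑ i ∈ range l, 6 * r (i + 1) t ≤ ∑ t : ι, (12 : ℝ) :=
      sum_le_sum fun t _ => by rw [← mul_sum]; linarith [(hrs t l).1]
    rw [sum_const, card_univ, nsmul_eq_mul] at h1
    linarith [hzs l, hcard l, hz0 l]
  obtain ⟨i, hi, hle⟩ := exists_le_of_sum_le (nonempty_range_iff.2 hl.ne') htot
  refine ⟨i, hi, U (i + 1), B (i + 1), fun t ht => subset_biUnion_of_mem S ht,
    (hB i).2.2, ?_, ?_⟩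
  · have h1 : z (i + 1) ≤ 2 * Fintype.card ι := by
      have := hzs (i + 1)
      have h2 : 0 ≤ ∑ j ∈ range (i + 1), z (j + 1) := sum_nonneg fun _ _ => hz0 _
      linarith [hcard (i + 1)]
    simp only [hz] at h1
    rw [div_le_iff₀ (by positivity)] at h1
    exact_mod_cast h1
  · refine le_trans (le_of_eq ?_) hle
    congr 1
    have h0 : ∑ t ∈ B (i + 1), 6 * r (i + 1) t = 0 :=
      sum_eq_zero fun t ht => by simp [hr, ht]
    rw [← sum_add_sum_compl (B (i + 1)), h0, zero_add]
    refine sum_congr rfl fun t ht => ?_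
    rw [mem_compl] at ht
    simp only [hr, if_neg ht]

/-! ### Random sets at a random scale -/

lemma exp_neg_inv_le {z : ℝ} (hz : 0 < z) : Real.exp (-z⁻¹) ≤ 1 - Real.exp (-z) := by
  have h1 : Real.exp (-z) ≤ (1 + z)⁻¹ := by
    rw [Real.exp_neg]
    exact inv_anti₀ (by positivity) (by linarith [Real.add_one_le_exp z])
  have h2 : Real.exp (-z⁻¹) ≤ (1 + z⁻¹)⁻¹ := by
    rw [Real.exp_neg]
    exact inv_anti₀ (by positivity) (by linarith [Real.add_one_le_exp z⁻¹])
  have h3 : (1 + z⁻¹)⁻¹ = 1 - (1 + z)⁻¹ := by field_simp; ring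
  linarith

lemma exp_neg_two_mul_le {p : ℝ} (hp₀ : 0 ≤ p) (hp : p ≤ 1 / 2) :
    Real.exp (-(2 * p)) ≤ 1 - p := by
  have h1 : Real.exp (-(2 * p)) ≤ (1 + 2 * p)⁻¹ := by
    rw [Real.exp_neg]
    exact inv_anti₀ (by positivity) (by linarith [Real.add_one_le_exp (2 * p)])
  refine h1.trans ?_
  rw [inv_le_iff_one_le_mul₀ (by positivity)]
  nlinarith

lemma exists_disjoint_third_card {V : Type*} [DecidableEq V] (s : Finset V) (hs : 2 ≤ #s) :
    ∃ P : Bool → Finset V, (∀ b, P b ⊆ s ∧ #s ≤ 3 * #(P b)) ∧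
      Disjoint (P false) (P true) := by
  obtain ⟨A, hA, hc⟩ := exists_subset_card_eq (show #s / 2 ≤ #s from Nat.div_le_self _ _)
  refine ⟨fun b => if b then A else s \ A, fun b => ?_, ?_⟩
  · cases b
    · have := card_sdiff_of_subset hA
      refine ⟨by simp, ?_⟩
      simp only [Bool.false_eq_true, if_false]
      omega
    · refine ⟨by simpa using hA, ?_⟩
      simp only [if_true]
      omega
  · simpa using sdiff_disjoint

/-- A lower bound for the probability that a random set avoids `U` and meets each of the given
sets at least twice. A set is met twice if each of two disjoint parts of it is met. -/
lemma exp_le_sum_bernoulliWeight {V ι : Type*} [Fintype V] [DecidableEq V] [DecidableEq ι]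
    {p : ℝ} (hp₀ : 0 < p) (hp : p ≤ 1 / 2) (S : ι → Finset V) (T : Finset ι) (U : Finset V)
    (hT : ∀ t ∈ T, 2 ≤ #(S t \ U)) :
    Real.exp (-(2 * (#U * p) + ∑ t ∈ T, 6 * (p * #(S t \ U))⁻¹)) ≤
      ∑ N : Finset V, if Disjoint N U ∧ ∀ t ∈ T, 2 ≤ #(N ∩ S t) then
        bernoulliWeight p univ N else 0 := by
  have hp₁ : p ≤ 1 := hp.trans (by norm_num)
  have hq : 0 ≤ 1 - p := sub_nonneg.2 hp₁
  choose! P hP hPd using fun t (ht : t ∈ T) => exists_disjoint_third_card _ (hT t ht)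
  have key := prod_le_sum_bernoulliWeight hp₀.le hp₁ (univ \ U) (T ×ˢ (univ : Finset Bool))
    (fun x => P x.1 x.2) fun x hx => ((hP x.1 (mem_product.1 hx).1 x.2).1).trans
      (sdiff_subset_sdiff (subset_univ _) le_rfl)
  have hU : Real.exp (-(2 * (#U * p))) ≤ (1 - p) ^ #U := by
    rw [show -(2 * (#U * p)) = #U * (-(2 * p)) by ring, Real.exp_nat_mul]
    exact pow_le_pow_left₀ (Real.exp_pos _).le (exp_neg_two_mul_le hp₀.le hp) _
  have hprod : Real.exp (-∑ t ∈ T, 6 * (p * #(S t \ U))⁻¹) ≤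
      ∏ x ∈ T ×ˢ (univ : Finset Bool), (1 - (1 - p) ^ #(P x.1 x.2)) := by
    rw [prod_product, ← sum_neg_distrib, Real.exp_sum]
    refine prod_le_prod (fun _ _ => (Real.exp_pos _).le) fun t ht => ?_
    have hb : ∀ b, Real.exp (-(3 * (p * #(S t \ U))⁻¹)) ≤ 1 - (1 - p) ^ #(P t b) := by
      intro b
      have h3 : (#(S t \ U) : ℝ) ≤ 3 * #(P t b) := by exact_mod_cast (hP t ht b).2
      have h2 : (2 : ℝ) ≤ #(S t \ U) := by exact_mod_cast hT t ht
      have hpos : (0 : ℝ) < #(P t b) := by linarith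
      have h4 : (1 - p) ^ #(P t b) ≤ Real.exp (-(p * #(P t b))) := by
        rw [show -(p * #(P t b)) = #(P t b) * (-p) by ring, Real.exp_nat_mul]
        exact pow_le_pow_left₀ hq (Real.one_sub_le_exp_neg p) _
      have h5 := exp_neg_inv_le (mul_pos hp₀ hpos)
      have h6 : (p * #(P t b))⁻¹ ≤ 3 * (p * #(S t \ U))⁻¹ := by
        rw [show 3 * (p * #(S t \ U))⁻¹ = (p * #(S t \ U) / 3)⁻¹ by rw [inv_div]; rfl]
        refine inv_anti₀ (by positivity) ?_
        nlinarith
      have h7 := Real.exp_le_exp.2 (neg_le_neg h6)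
      linarith
    rw [Fintype.prod_bool, show -(6 * (p * #(S t \ U))⁻¹) =
      -(3 * (p * #(S t \ U))⁻¹) + -(3 * (p * #(S t \ U))⁻¹) by ring, Real.exp_add]
    exact mul_le_mul (hb _) (hb _) (Real.exp_pos _).le
      ((Real.exp_pos _).le.trans (hb _))
  rw [neg_add, Real.exp_add]
  refine (mul_le_mul hU (hprod.trans key) (Real.exp_pos _).le (pow_nonneg hq _)).trans ?_
  rw [mul_sum]
  refine (sum_le_sum fun N hN => ?_).trans (sum_le_sum_of_subset_of_nonneg
    (subset_univ (univ \ U).powerset) fun N _ _ => ?_)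
  · have hNU : N ⊆ univ \ U := mem_powerset.1 hN
    have hd : Disjoint N U := disjoint_of_subset_left hNU sdiff_disjoint
    by_cases h : ∀ x ∈ T ×ˢ (univ : Finset Bool), (N ∩ P x.1 x.2).Nonempty
    · have h2 : ∀ t ∈ T, 2 ≤ #(N ∩ S t) := fun t ht => by
        obtain ⟨a, ha⟩ := h (t, false) (mem_product.2 ⟨ht, mem_univ _⟩)
        obtain ⟨b, hb⟩ := h (t, true) (mem_product.2 ⟨ht, mem_univ _⟩)
        rw [mem_inter] at ha hb
        have hab : a ≠ b := fun e => disjoint_left.1 (hPd t ht) ha.2 (e ▸ hb.2)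
        exact one_lt_card.2 ⟨a, mem_inter.2 ⟨ha.1, sdiff_subset ((hP t ht _).1 ha.2)⟩,
          b, mem_inter.2 ⟨hb.1, sdiff_subset ((hP t ht _).1 hb.2)⟩, hab⟩
      rw [if_pos h, if_pos ⟨hd, h2⟩]
      have e : univ \ N = U ∪ ((univ \ U) \ N) := by
        ext x
        have : x ∈ N → x ∉ U := fun a b => disjoint_left.1 hd a b
        simp only [mem_sdiff, mem_univ, true_and, mem_union]
        tauto
      have hd2 : Disjoint U ((univ \ U) \ N) :=
        disjoint_of_subset_right sdiff_subset disjoint_sdiff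
      rw [bernoulliWeight, bernoulliWeight, e, card_union_of_disjoint hd2, pow_add]
      exact le_of_eq (by ring)
    · rw [if_neg h, mul_zero]
      split_ifs
      exacts [bernoulliWeight_nonneg hp₀.le hp₁ _ _, le_rfl]
  · split_ifs
    exacts [bernoulliWeight_nonneg hp₀.le hp₁ _ _, le_rfl]

/-- The weight of a set of random size: the sum, over `l` scales `i`, of the probabilities
that `N` arises by choosing the elements independently with probability `2 ^ (-(i + 1))`. -/
noncomputable def multiscaleWeight {V : Type*} [Fintype V] [DecidableEq V] (l : ℕ)
    (N : Finset V) : ℝ :=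
  ∑ i ∈ range l, bernoulliWeight (1 / 2 ^ (i + 1)) univ N

lemma scale_prob (i : ℕ) : (0 : ℝ) < 1 / 2 ^ (i + 1) ∧ (1 : ℝ) / 2 ^ (i + 1) ≤ 1 / 2 := by
  refine ⟨by positivity, one_div_le_one_div_of_le (by norm_num) ?_⟩
  rw [pow_succ]
  linarith [one_le_pow₀ (one_le_two : (1 : ℝ) ≤ 2) (n := i)]

lemma multiscaleWeight_nonneg {V : Type*} [Fintype V] [DecidableEq V] (l : ℕ)
    (N : Finset V) : 0 ≤ multiscaleWeight l N :=
  sum_nonneg fun i _ => bernoulliWeight_nonneg (scale_prob i).1.le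
    ((scale_prob i).2.trans (by norm_num)) _ _

lemma sum_multiscaleWeight {V : Type*} [Fintype V] [DecidableEq V] (l : ℕ) :
    ∑ N : Finset V, multiscaleWeight l N = l := by
  simp only [multiscaleWeight]
  rw [sum_comm]
  simp [← powerset_univ, sum_bernoulliWeight]

/-- For any sets `S t`, a random set of random size has a substantial chance to be nonempty and
to meet none of the sets `S t` in exactly one element. The whole space is added to the sets, to
force a nonempty set; it is too large to be absorbed. -/
lemma exp_le_sum_multiscaleWeight {V ι : Type*} [Fintype V] [DecidableEq V] [Fintype ι]
    (S : ι → Finset V) {l : ℕ} (hl : 0 < l)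
    (hV : 2 * (Fintype.card ι + 1) * 2 ^ l < Fintype.card V) :
    Real.exp (-(16 * (Fintype.card ι + 1) / l)) ≤
      ∑ N : Finset V, if N.Nonempty ∧ ∀ t, #(N ∩ S t) ≠ 1 then multiscaleWeight l N else 0 := by
  classical
  obtain ⟨i, hi, U, B, hB, hBc, hU, hcost⟩ :=
    exists_scale (fun t : Option ι => t.elim univ S) hl
  rw [Fintype.card_option] at hU hcost
  push_cast at hcost
  have hnone : none ∉ B := fun h => by
    have h1 := card_le_card (hB none h)
    have h2 : 2 ^ (i + 1) ≤ 2 ^ l := Nat.pow_le_pow_right two_pos (mem_range.1 hi)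
    have h3 := Nat.mul_le_mul_left (2 * (Fintype.card ι + 1)) h2
    simp only [Option.elim_none, card_univ] at h1
    omega
  have key := exp_le_sum_bernoulliWeight (scale_prob i).1 (scale_prob i).2
    (fun t : Option ι => t.elim univ S) Bᶜ U fun t ht => by
      have h1 := hBc t (mem_compl.1 ht)
      have h2 : 2 ^ 1 ≤ 2 ^ (i + 1) := Nat.pow_le_pow_right two_pos (by omega)
      omega
  refine (Real.exp_le_exp.2 (neg_le_neg ?_)).trans (key.trans (sum_le_sum fun N _ => ?_))
  · refine le_trans (le_of_eq ?_) hcost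
    congr 1
    · ring
    · refine sum_congr rfl fun t _ => ?_
      rw [one_div_mul_eq_div, inv_div]
  · have hle : bernoulliWeight (1 / 2 ^ (i + 1)) univ N ≤ multiscaleWeight l N :=
      single_le_sum (f := fun i => bernoulliWeight (1 / 2 ^ (i + 1)) univ N)
        (fun i _ => bernoulliWeight_nonneg (scale_prob i).1.le
          ((scale_prob i).2.trans (by norm_num)) _ _) hi
    split_ifs with h1 h2 h2
    · exact hle
    · refine absurd ⟨?_, fun t => ?_⟩ h2
      · have := h1.2 none (mem_compl.2 hnone)
        simp only [Option.elim_none, inter_univ] at this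
        exact card_pos.1 (by omega)
      · by_cases ht : some t ∈ B
        · have : N ∩ S t = ∅ := disjoint_iff_inter_eq_empty.1
            (disjoint_of_subset_right (hB _ ht) h1.1)
          simp [this]
        · have := h1.2 (some t) (mem_compl.2 ht)
          simp only [Option.elim_some] at this
          omega
    · exact multiscaleWeight_nonneg _ _
    · exact le_rfl

/-! ### A covering family -/

/-- Greedy covering: if every `y` in `Y` is related to a fraction `δ` of the weight, then some
`M` points leave at most a fraction `(1 - δ) ^ M` of `Y` unrelated to all of them. -/
lemma exists_greedy_cover {X Z : Type*} [Fintype X] (w : X → ℝ) (hw : ∀ x, 0 ≤ w x)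
    (R : X → Z → Prop) [∀ x y, Decidable (R x y)] (Y : Finset Z) {δ : ℝ} (hδ : δ ≤ 1)
    (hW : 0 < ∑ x, w x) (h : ∀ y ∈ Y, δ * ∑ x, w x ≤ ∑ x, if R x y then w x else 0) (M : ℕ) :
    ∃ f : ℕ → X, (#{y ∈ Y | ∀ i < M, ¬ R (f i) y} : ℝ) ≤ (1 - δ) ^ M * #Y := by
  classical
  induction M with
  | zero =>
    have : Nonempty X := by
      by_contra hX
      rw [not_nonempty_iff] at hX
      simp at hW
    exact ⟨fun _ => Classical.arbitrary X, by simp⟩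
  | succ M ih =>
    obtain ⟨f, hf⟩ := ih
    set Y' := {y ∈ Y | ∀ i < M, ¬ R (f i) y} with hY'
    have hsum : ∑ x, w x * (δ * #Y') ≤ ∑ x, w x * #{y ∈ Y' | R x y} := by
      calc ∑ x, w x * (δ * #Y') = ∑ y ∈ Y', δ * ∑ x, w x := by
            rw [sum_const, ← sum_mul, nsmul_eq_mul]; ring
        _ ≤ ∑ y ∈ Y', ∑ x, (if R x y then w x else 0) :=
            sum_le_sum fun y hy => h y (mem_filter.1 hy).1
        _ = ∑ x, w x * #{y ∈ Y' | R x y} := by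
            rw [sum_comm]
            refine sum_congr rfl fun x _ => ?_
            rw [← sum_filter, sum_const, nsmul_eq_mul, mul_comm]
    obtain ⟨x, hx⟩ : ∃ x, δ * #Y' ≤ #{y ∈ Y' | R x y} := by
      by_contra! hlt
      obtain ⟨x₀, -, hx₀⟩ := exists_lt_of_sum_lt (s := univ) (f := fun _ : X => (0 : ℝ))
        (g := w) (by simpa using hW)
      exact absurd hsum (not_le.2 (sum_lt_sum
        (fun x _ => mul_le_mul_of_nonneg_left (hlt x).le (hw x))
        ⟨x₀, mem_univ _, mul_lt_mul_of_pos_left (hlt x₀) hx₀⟩))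
    refine ⟨Function.update f M x, ?_⟩
    have e : {y ∈ Y | ∀ i < M + 1, ¬ R (Function.update f M x i) y} =
        {y ∈ Y' | ¬ R x y} := by
      ext y
      simp only [hY', mem_filter, Nat.forall_lt_succ_right, Function.update_self, and_assoc]
      refine and_congr_right fun _ => and_congr_left fun _ => ?_
      exact forall₂_congr fun i hi => by rw [Function.update_of_ne hi.ne]
    have hc : (#{y ∈ Y' | R x y} : ℝ) + #{y ∈ Y' | ¬ R x y} = #Y' := by
      exact_mod_cast card_filter_add_card_filter_not (s := Y') (fun y => R x y)
    rw [e, pow_succ]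
    nlinarith [mul_le_mul_of_nonneg_left hf (sub_nonneg.2 hδ)]

/-- A family of polynomially many neighbourhoods that defeats every short schedule: whichever
sets `S t` transmit in the successive rounds, some neighbourhood never contains exactly one
transmitter. -/
lemma exists_family_defeating_schedules {l : ℕ} (hl : 8 ≤ l) :
    ∃ F : ℕ → Finset (Fin (8 ^ l)), (∀ j, (F j).Nonempty) ∧
      ∀ S : Fin (l ^ 2 / 64) → Finset (Fin (8 ^ l)),
        ∃ j < 128 ^ l, ∀ t, #(F j ∩ S t) ≠ 1 := by
  classical
  set T := l ^ 2 / 64 with hTdef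
  have hl2 : 64 ≤ l ^ 2 := by nlinarith
  have hT64 : T * 64 ≤ l ^ 2 := Nat.div_mul_le_self _ _
  have hsq : l ^ 2 < 4 ^ l := by
    rw [show 4 = 2 ^ 2 by norm_num, ← pow_mul, mul_comm, pow_mul]
    exact Nat.pow_lt_pow_left Nat.lt_two_pow_self two_ne_zero
  have hV : 2 * (Fintype.card (Fin T) + 1) * 2 ^ l < Fintype.card (Fin (8 ^ l)) := by
    rw [Fintype.card_fin, Fintype.card_fin, show 8 = 4 * 2 by norm_num, mul_pow]
    exact Nat.mul_lt_mul_of_pos_right (by omega) (by positivity)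
  have hlR : (8 : ℝ) ≤ l := by exact_mod_cast hl
  have hexp : (1 / 4 : ℝ) ^ l * l ≤ Real.exp (-(16 * (Fintype.card (Fin T) + 1) / l)) := by
    have h1 : 16 * ((Fintype.card (Fin T) : ℝ) + 1) / l ≤ l * (1 / 2) := by
      rw [Fintype.card_fin, div_le_iff₀ (by positivity)]
      have : (T : ℝ) * 64 ≤ l ^ 2 := by exact_mod_cast hT64
      nlinarith
    have h2 : Real.exp (-(l * (1 / 2))) ≥ (1 / 2 : ℝ) ^ l := by
      have h3 : (1 / 2 : ℝ) ≤ Real.exp (-(1 / 2)) := by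
        linarith [Real.add_one_le_exp (-(1 / 2) : ℝ)]
      rw [show -((l : ℝ) * (1 / 2)) = l * (-(1 / 2)) by ring, Real.exp_nat_mul]
      exact pow_le_pow_left₀ (by norm_num) h3 _
    have h4 : (l : ℝ) ≤ 2 ^ l := by exact_mod_cast Nat.lt_two_pow_self.le
    calc (1 / 4 : ℝ) ^ l * l ≤ (1 / 4 : ℝ) ^ l * 2 ^ l :=
          mul_le_mul_of_nonneg_left h4 (by positivity)
      _ = (1 / 2 : ℝ) ^ l := by rw [← mul_pow]; norm_num
      _ ≤ _ := h2.le.trans (Real.exp_le_exp.2 (neg_le_neg h1))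
  obtain ⟨f, hf⟩ := exists_greedy_cover (multiscaleWeight l) (multiscaleWeight_nonneg l)
    (fun (N : Finset (Fin (8 ^ l))) (S : Fin T → Finset (Fin (8 ^ l))) =>
      N.Nonempty ∧ ∀ t, #(N ∩ S t) ≠ 1) univ (δ := (1 / 4 : ℝ) ^ l)
    (pow_le_one₀ (by norm_num) (by norm_num))
    (by rw [sum_multiscaleWeight]; positivity)
    (fun S _ => by
      rw [sum_multiscaleWeight]
      refine (hexp.trans (exp_le_sum_multiscaleWeight S (by omega) hV)).trans_eq
        (sum_congr rfl fun N _ => ?_)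
      congr)
    (128 ^ l)
  have hlt : (1 - (1 / 4 : ℝ) ^ l) ^ 128 ^ l *
      #(univ : Finset (Fin T → Finset (Fin (8 ^ l)))) < 1 := by
    have h1 : (1 - (1 / 4 : ℝ) ^ l) ^ 128 ^ l ≤ Real.exp (-(32 ^ l)) := by
      have e : -(32 : ℝ) ^ l = ((128 ^ l : ℕ) : ℝ) * (-(1 / 4 : ℝ) ^ l) := by
        push_cast
        rw [mul_neg, ← mul_pow]
        norm_num
      rw [e, Real.exp_nat_mul]
      exact pow_le_pow_left₀ (sub_nonneg.2 (pow_le_one₀ (by norm_num) (by norm_num)))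
        (Real.one_sub_le_exp_neg _) _
    have h2 : (#(univ : Finset (Fin T → Finset (Fin (8 ^ l)))) : ℝ) ≤
        Real.exp (8 ^ l * T) := by
      have h3 : (2 : ℝ) ≤ Real.exp 1 := by linarith [Real.add_one_le_exp (1 : ℝ)]
      rw [card_univ, Fintype.card_fun, Fintype.card_finset, Fintype.card_fin, Fintype.card_fin,
        ← pow_mul, show (8 : ℝ) ^ l * T = ((8 ^ l * T : ℕ) : ℝ) * 1 by push_cast; ring,
        Real.exp_nat_mul]
      push_cast
      exact pow_le_pow_left₀ (by norm_num) h3 _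
    have h4 : (8 : ℝ) ^ l * T < 32 ^ l := by
      rw [show (32 : ℝ) = 8 * 4 by norm_num, mul_pow]
      have : (T : ℝ) < 4 ^ l := by exact_mod_cast (show T < 4 ^ l by omega)
      exact mul_lt_mul_of_pos_left this (by positivity)
    refine (mul_le_mul h1 h2 (by positivity) (Real.exp_pos _).le).trans_lt ?_
    rw [← Real.exp_add, Real.exp_lt_one_iff]
    linarith
  have h0 := hf.trans_lt hlt
  rw [Nat.cast_lt_one, card_eq_zero, filter_eq_empty_iff] at h0
  have : Nonempty (Fin (8 ^ l)) := ⟨⟨0, by positivity⟩⟩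
  -- Empty neighbourhoods never help, and are replaced to keep the network connected.
  refine ⟨fun j => if (f j).Nonempty then f j else univ, fun j => ?_, fun S => ?_⟩
  · by_cases h : (f j).Nonempty <;> simp [h]
  · have h := h0 (mem_univ S)
    push Not at h
    obtain ⟨j, hj, hne, ht⟩ := h
    exact ⟨j, hj, fun t => by simpa only [if_pos hne] using ht t⟩

/-! ### Networks with a silent node -/

/-- The network with a clique `Fin m` and `M` further nodes, the `j`-th of which is adjacent
exactly to the clique nodes in `F j`. -/
def twoLayerGraph (m M : ℕ) (F : ℕ → Finset (Fin m)) : SimpleGraph (Fin m ⊕ Fin M) where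
  Adj
    | .inl a, .inl b => a ≠ b
    | .inl a, .inr j => a ∈ F j
    | .inr j, .inl a => a ∈ F j
    | .inr _, .inr _ => False
  symm := ⟨by
    rintro (a | i) (b | j) h
    exacts [Ne.symm h, h, h, h]⟩
  loopless := ⟨by
    rintro (a | i) h
    exacts [h rfl, h]⟩

lemma twoLayerGraph_connected {m : ℕ} (M : ℕ) (hm : 0 < m) (F : ℕ → Finset (Fin m))
    (hF : ∀ j, (F j).Nonempty) : (twoLayerGraph m M F).Connected := by
  rw [SimpleGraph.connected_iff_exists_forall_reachable]
  have hcl : ∀ b : Fin m, (twoLayerGraph m M F).Reachable (.inl ⟨0, hm⟩) (.inl b) := fun b => by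
    by_cases h : (⟨0, hm⟩ : Fin m) = b
    · rw [h]
    · exact SimpleGraph.Adj.reachable (show (twoLayerGraph m M F).Adj _ _ from h)
  refine ⟨.inl ⟨0, hm⟩, ?_⟩
  rintro (b | j)
  · exact hcl b
  · obtain ⟨a, ha⟩ := hF j
    exact (hcl a).trans (SimpleGraph.Adj.reachable (show (twoLayerGraph m M F).Adj _ _ from ha))

lemma history_eq_replicate {V : Type*} (A : Algorithm) (G : SimpleGraph V)
    (lab : V → BinString) (v : V) (T : ℕ)
    (h : ∀ t < T, ¬ ∃! w, G.Adj v w ∧ A.action (lab w) (history A G lab t w) ≠ none) :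
    ∀ t ≤ T, history A G lab t v = List.replicate t none := by
  intro t
  induction t with
  | zero => intro _; rfl
  | succ t ih =>
    intro ht
    rw [history, ih (by omega), heard, dif_neg fun h' => h t (by omega) h'.2,
      List.replicate_succ']

/-- On the two-layer network, whatever the algorithm and the labels, some node of the second
layer hears nothing for as long as the family `F` defeats the schedules. -/
lemma exists_silent_node {m M k T : ℕ} (F : ℕ → Finset (Fin m))
    (hF : ∀ S : Fin T → Finset (Fin m), ∃ j < M, ∀ t, #(F j ∩ S t) ≠ 1)
    (e : Fin k ≃ Fin m ⊕ Fin M) (A : Algorithm) (lab : Fin k → BinString) :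
    ∃ v, ∀ t ≤ T, history A ((twoLayerGraph m M F).comap e) lab t v =
      List.replicate t none := by
  classical
  set G := (twoLayerGraph m M F).comap e with hG
  set tr : ℕ → Fin k → Prop := fun t w =>
    A.action (lab w) (history A G lab t w) ≠ none with htr
  obtain ⟨j, hj, hjt⟩ := hF fun t => {a | tr t (e.symm (.inl a))}
  refine ⟨e.symm (.inr ⟨j, hj⟩), history_eq_replicate A G lab _ T fun t ht => ?_⟩
  rintro ⟨w, ⟨hadj, hw⟩, huniq⟩
  have hadj' : (twoLayerGraph m M F).Adj (.inr ⟨j, hj⟩) (e w) := by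
    simpa [hG] using hadj
  rcases hew : e w with a | i
  · rw [hew] at hadj'
    have hwa : w = e.symm (.inl a) := by rw [← hew, e.symm_apply_apply]
    refine hjt ⟨t, ht⟩ (card_eq_one.2 ⟨a, ?_⟩)
    ext b
    simp only [mem_inter, mem_filter, mem_univ, true_and, mem_singleton]
    constructor
    · rintro ⟨hb, hbt⟩
      have := huniq (e.symm (.inl b)) ⟨by
        simp only [hG, SimpleGraph.comap_adj, Equiv.apply_symm_apply]
        exact hb, hbt⟩
      rw [hwa] at this
      exact Sum.inl_injective (e.symm.injective this)
    · rintro rfl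
      exact ⟨hadj', hwa ▸ hw⟩
  · rw [hew] at hadj'
    exact hadj'.elim

lemma OutputsAt.unique {V : Type*} {A : Algorithm} {G : SimpleGraph V} {lab : V → BinString}
    {v : V} {s t x y : ℕ} (hs : OutputsAt A G lab v s x) (ht : OutputsAt A G lab v t y) :
    s = t ∧ x = y := by
  have hst : s = t := by
    rcases lt_trichotomy s t with h | h | h
    · exact absurd hs.1 (by rw [ht.2 s h]; simp)
    · exact h
    · exact absurd ht.1 (by rw [hs.2 t h]; simp)
  subst hst
  exact ⟨rfl, Option.some_injective _ (hs.1.symm.trans ht.1)⟩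

lemma exists_finishedBy_of_runningTime_lt {V : Type*} {A : Algorithm} {G : SimpleGraph V}
    {lab : V → BinString} {T : ℕ} (h : runningTime A G lab < T) :
    ∃ T' < T, FinishedBy A G lab T' := by
  rw [runningTime, iInf_lt_iff] at h
  obtain ⟨T', h⟩ := h
  rw [iInf_lt_iff] at h
  obtain ⟨hf, hlt⟩ := h
  exact ⟨T', by exact_mod_cast hlt, hf⟩

/-! ### Counting labels -/

/-- The number whose binary digits are those of the string, preceded by a leading one. -/
def stringCode : BinString → ℕ
  | [] => 1
  | b :: s => 2 * stringCode s + b.toNat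

lemma stringCode_pos (s : BinString) : 0 < stringCode s := by
  induction s with
  | nil => exact one_pos
  | cons b s ih => rw [stringCode]; omega

lemma stringCode_lt (s : BinString) : stringCode s < 2 ^ (s.length + 1) := by
  induction s with
  | nil => simp [stringCode]
  | cons b s ih =>
    have := b.toNat_lt
    rw [stringCode, List.length_cons, pow_succ]
    omega

lemma stringCode_injective : Function.Injective stringCode := by
  intro s
  induction s with
  | nil =>
    intro s' h
    cases s' with
    | nil => rfl
    | cons b s' =>
      have := stringCode_pos s'
      simp only [stringCode] at h
      omega
  | cons b s ih =>
    intro s' h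
    cases s' with
    | nil =>
      have := stringCode_pos s
      simp only [stringCode] at h
      omega
    | cons b' s' =>
      simp only [stringCode] at h
      have := b.toNat_lt
      have := b'.toNat_lt
      have hb : b = b' := by cases b <;> cases b' <;> simp at h ⊢ <;> omega
      rw [ih (show stringCode s = stringCode s' by omega), hb]

/-- If size discovery is fast on the networks of size at most `n`, then each of the many sizes
`8 ^ l + (128 ^ l + j)` up to `n` is the output of a node that has heard nothing, hence is
determined by a label; there are fewer short labels than sizes. -/
lemma le_timeComplexity {n : ℕ} (hn : 64 ≤ Nat.log 2 n) (A : Algorithm) (L : LabelingScheme)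
    (hL : ∀ k ≤ n, ∀ G : SimpleGraph (Fin k), G.Connected →
      (labelingLength (L k G) : ℝ) < 1 / 4 * Real.logb 2 n)
    (hA : SolvesUpTo A L n) :
    (((Nat.log 2 n / 8) ^ 2 / 64 : ℕ) : ℕ∞) ≤ timeComplexity A L n := by
  by_contra! hlt
  set q := Nat.log 2 n with hq
  set l := q / 8 with hl
  have hn0 : n ≠ 0 := by rintro rfl; simp [hq] at hn
  obtain ⟨F, hF, hS⟩ := exists_family_defeating_schedules (l := l) (by omega)
  have hsize : ∀ j, 8 ^ l + (128 ^ l + j) ≤ n → ∃ x : BinString, x.length ≤ q / 4 ∧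
      ∃ t, A.output x (List.replicate t none) = some (8 ^ l + (128 ^ l + j)) ∧
        ∀ s < t, A.output x (List.replicate s none) = none := by
    intro j hj
    set k := 8 ^ l + (128 ^ l + j) with hk
    set G := (twoLayerGraph (8 ^ l) (128 ^ l + j) F).comap
      (finSumFinEquiv (m := 8 ^ l) (n := 128 ^ l + j)).symm with hG
    have hconn : G.Connected := (SimpleGraph.Iso.comap _ _).connected_iff.2
      (twoLayerGraph_connected _ (by positivity) F hF)
    obtain ⟨v, hv⟩ := exists_silent_node F
      (fun S => (hS S).imp fun i hi => ⟨hi.1.trans_le (Nat.le_add_right _ j), hi.2⟩)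
      finSumFinEquiv.symm A (L k G)
    have hrun : runningTime A G (L k G) ≤ timeComplexity A L n :=
      le_iSup_of_le k (le_iSup_of_le hj (le_iSup_of_le G (le_iSup_of_le hconn le_rfl)))
    obtain ⟨T', hT', hfin⟩ := exists_finishedBy_of_runningTime_lt (hrun.trans_lt hlt)
    obtain ⟨t, ht, x, hx⟩ := hfin v
    obtain ⟨t', ht'⟩ := hA k hj G hconn v
    obtain ⟨rfl, rfl⟩ := hx.unique ht'
    rw [Fintype.card_fin] at hx
    refine ⟨L k G v, ?_, t, ?_, fun s hs => ?_⟩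
    · have h1 : (L k G v).length ≤ labelingLength (L k G) :=
        le_sup (f := fun v => (L k G v).length) (mem_univ v)
      have h2 := hL k hj G hconn
      have h3 : ((4 * (L k G v).length : ℕ) : ℝ) < Real.logb 2 n := by
        have : ((L k G v).length : ℝ) ≤ labelingLength (L k G) := by exact_mod_cast h1
        push_cast
        linarith
      rw [Real.lt_logb_iff_rpow_lt one_lt_two (by positivity), Real.rpow_natCast] at h3
      have h4 : 2 ^ (4 * (L k G v).length) ≤ n := by exact_mod_cast h3.le
      have := Nat.le_log_of_pow_le one_lt_two h4
      omega
    · rw [← hv t (by omega)]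
      exact hx.1
    · rw [← hv s (by omega)]
      exact hx.2 s hs
  choose! x hxl t ht hts using hsize
  have hcard := card_le_card_of_injOn (s := range (n + 1 - (8 ^ l + 128 ^ l)))
    (t := range (2 ^ (q / 4 + 1))) (fun j => stringCode (x j))
    (fun j hj => by
      rw [mem_coe, mem_range] at hj
      rw [mem_coe, mem_range]
      exact (stringCode_lt _).trans_le
        (Nat.pow_le_pow_right two_pos (Nat.succ_le_succ (hxl j (by omega)))))
    (fun i hi j hj hij => by
      rw [mem_coe, mem_range] at hi hj
      have hi' : 8 ^ l + (128 ^ l + i) ≤ n := by omega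
      have hj' : 8 ^ l + (128 ^ l + j) ≤ n := by omega
      have hx := stringCode_injective hij
      have h1 := ht i hi'
      have h2 := ht j hj'
      rw [hx] at h1
      have htt : t i = t j := by
        rcases lt_trichotomy (t i) (t j) with h | h | h
        · rw [hts j hj' _ h] at h1
          cases h1
        · exact h
        · have := hts i hi' _ h
          rw [hx, h2] at this
          cases this
      rw [htt, h2] at h1
      have := Option.some_injective _ h1
      omega)
  rw [card_range, card_range] at hcard
  have e1 : 8 ^ l ≤ 2 ^ (q - 3) := by
    rw [show 8 = 2 ^ 3 by norm_num, ← pow_mul]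
    exact Nat.pow_le_pow_right two_pos (by omega)
  have e2 : 128 ^ l ≤ 2 ^ (q - 3) := by
    rw [show 128 = 2 ^ 7 by norm_num, ← pow_mul]
    exact Nat.pow_le_pow_right two_pos (by omega)
  have e3 : 2 ^ (q / 4 + 1) ≤ 2 ^ (q - 3) := Nat.pow_le_pow_right two_pos (by omega)
  have e4 : 2 ^ (q - 3) * 8 ≤ n := by
    rw [show 8 = 2 ^ 3 by norm_num, ← pow_add, Nat.sub_add_cancel (by omega)]
    exact Nat.pow_log_le_self 2 hn0
  omega

/-! ### Asymptotic comparisons -/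

lemma const_mul_logb_sq_le {n : ℕ} (hn : 2 ^ 128 ≤ n) :
    1 / 32768 * Real.logb 2 n ^ 2 ≤ ((Nat.log 2 n / 8) ^ 2 / 64 : ℕ) := by
  have hn0 : n ≠ 0 := by rintro rfl; norm_num at hn
  have hq : 128 ≤ Nat.log 2 n := Nat.le_log_of_pow_le one_lt_two hn
  set q := Nat.log 2 n with hqd
  have h1 : Real.logb 2 n ≤ q + 1 := by
    rw [Real.logb_le_iff_le_rpow one_lt_two (by positivity)]
    have := (Nat.lt_pow_succ_log_self one_lt_two n).le
    exact_mod_cast this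
  have h0 : 0 ≤ Real.logb 2 n := Real.logb_nonneg one_lt_two (by
    exact_mod_cast Nat.one_le_iff_ne_zero.2 hn0)
  have h2 : (q + 1 : ℝ) ≤ 16 * (q / 8 : ℕ) := by
    exact_mod_cast (show q + 1 ≤ 16 * (q / 8) by omega)
  have h3 : (((q / 8) ^ 2 : ℕ) : ℝ) ≤ 128 * ((q / 8) ^ 2 / 64 : ℕ) := by
    have : 16 ^ 2 ≤ (q / 8) ^ 2 := Nat.pow_le_pow_left (by omega) 2
    exact_mod_cast (show (q / 8) ^ 2 ≤ 128 * ((q / 8) ^ 2 / 64) by omega)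
  have h4 : Real.logb 2 n ^ 2 ≤ (16 * (q / 8 : ℕ)) ^ 2 :=
    pow_le_pow_left₀ h0 (h1.trans h2) 2
  push_cast at h3 h4 ⊢
  nlinarith

/-- Labels of length `O(log log Δ)` are eventually shorter than `log n / 4`. -/
lemma exists_forall_loglog_lt (C : ℝ) : ∃ N : ℕ, ∀ n : ℕ, N ≤ n → ∀ d : ℕ, d < n →
    C * (1 + Real.logb 2 (Real.logb 2 (d + 2))) < 1 / 4 * Real.logb 2 n := by
  have hlog2 : 0 < Real.log 2 := Real.log_pos one_lt_two
  have hlim : Filter.Tendsto (fun n : ℕ => Real.logb 2 n) Filter.atTop Filter.atTop :=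
    (Real.tendsto_logb_atTop one_lt_two).comp tendsto_natCast_atTop_atTop
  have hsmall : ∀ᶠ y : ℝ in Filter.atTop, |C| * (1 + Real.logb 2 (2 * y)) < 1 / 4 * y := by
    have ho := Real.isLittleO_log_id_atTop.def
      (show (0 : ℝ) < Real.log 2 / (16 * (|C| + 1)) by positivity)
    filter_upwards [ho, Filter.eventually_ge_atTop (16 * (|C| + 1))] with y hy hyC
    have hC := abs_nonneg C
    have hy0 : 0 < y := by linarith
    have h1 : Real.log y ≤ Real.log 2 / (16 * (|C| + 1)) * y := by
      rw [Real.norm_eq_abs, id, Real.norm_eq_abs, abs_of_pos hy0] at hy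
      exact (le_abs_self _).trans hy
    have h2 : Real.logb 2 y ≤ y / (16 * (|C| + 1)) := by
      rw [Real.logb, div_le_iff₀ hlog2]
      exact h1.trans_eq (by ring)
    have h3 : Real.logb 2 (2 * y) = 1 + Real.logb 2 y := by
      rw [Real.logb_mul two_ne_zero hy0.ne', Real.logb_self_eq_one one_lt_two]
    rw [h3]
    have h5 : (|C| + 1) * (y / (16 * (|C| + 1))) = y / 16 := by field_simp
    have h6 : |C| * Real.logb 2 y ≤ y / 16 := by
      have : 0 ≤ y / (16 * (|C| + 1)) := by positivity
      nlinarith [mul_le_mul_of_nonneg_left h2 hC]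
    nlinarith
  obtain ⟨N, hN⟩ := Filter.eventually_atTop.1 (hlim.eventually hsmall)
  refine ⟨max N 2, fun n hn d hd => lt_of_le_of_lt ?_ (hN n (le_trans (le_max_left _ _) hn))⟩
  have hn2 : (2 : ℝ) ≤ n := by exact_mod_cast (le_max_right N 2).trans hn
  have hd1 : (d : ℝ) + 1 ≤ n := by exact_mod_cast hd
  have hd0 : (0 : ℝ) ≤ d := Nat.cast_nonneg d
  have h1 : 1 ≤ Real.logb 2 (d + 2) := by
    rw [Real.le_logb_iff_rpow_le one_lt_two (by positivity)]
    simp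
  have h2 : Real.logb 2 (d + 2) ≤ 2 * Real.logb 2 n := by
    rw [show 2 * Real.logb 2 n = Real.logb 2 ((n : ℝ) ^ 2) by rw [Real.logb_pow]; norm_num]
    exact Real.logb_le_logb_of_le one_lt_two (by positivity) (by nlinarith)
  have h3 : 0 ≤ Real.logb 2 (Real.logb 2 (d + 2)) := Real.logb_nonneg one_lt_two h1
  have h4 : Real.logb 2 (Real.logb 2 (d + 2)) ≤ Real.logb 2 (2 * Real.logb 2 n) :=
    Real.logb_le_logb_of_le one_lt_two (by linarith) h2
  exact mul_le_mul (le_abs_self C) (by linarith) (by linarith) (abs_nonneg C)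

lemma maxDeg_lt {k : ℕ} {G : SimpleGraph (Fin k)} (hG : G.Connected) : maxDeg G < k := by
  classical
  have := hG.nonempty
  have h := G.maxDegree_lt_card_verts
  rw [Fintype.card_fin] at h
  rw [maxDeg]
  convert h

lemma logb_sq_le_timeComplexity {n : ℕ} (hn : 2 ^ 128 ≤ n) (A : Algorithm) (L : LabelingScheme)
    (hL : ∀ k ≤ n, ∀ G : SimpleGraph (Fin k), G.Connected →
      (labelingLength (L k G) : ℝ) < 1 / 4 * Real.logb 2 n)
    (hA : SolvesUpTo A L n) :
    ENNReal.ofReal (1 / 32768 * Real.logb 2 n ^ 2) ≤ (timeComplexity A L n : ENNReal) := by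
  have hq : 128 ≤ Nat.log 2 n := Nat.le_log_of_pow_le one_lt_two hn
  refine (ENNReal.ofReal_le_ofReal (const_mul_logb_sq_le hn)).trans ?_
  rw [ENNReal.ofReal_natCast]
  have := ENat.toENNReal_le.2 (le_timeComplexity (by omega) A L hL hA)
  simpa using this

end RadioNetwork

theorem mainTheorem5 :
    ∃ c : ℝ, 0 < c ∧
      (∃ N : ℕ, ∀ n : ℕ, N ≤ n →
        ∀ (A : RadioNetwork.Algorithm) (L : RadioNetwork.LabelingScheme),
          (∀ k ≤ n, ∀ G : SimpleGraph (Fin k), G.Connected →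
            (RadioNetwork.labelingLength (L k G) : ℝ) < 1 / 4 * Real.logb 2 n) →
          RadioNetwork.SolvesUpTo A L n →
          ENNReal.ofReal (c * Real.logb 2 n ^ 2) ≤ (RadioNetwork.timeComplexity A L n : ENNReal)) ∧
      (∀ C : ℝ, ∃ N : ℕ, ∀ (A : RadioNetwork.Algorithm) (L : RadioNetwork.LabelingScheme),
          (∀ (k : ℕ) (G : SimpleGraph (Fin k)), G.Connected →
            (RadioNetwork.labelingLength (L k G) : ℝ) ≤
              C * (1 + Real.logb 2 (Real.logb 2 (RadioNetwork.maxDeg G + 2)))) →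
          (∀ n : ℕ, RadioNetwork.SolvesUpTo A L n) →
          ∀ n : ℕ, N ≤ n →
            ENNReal.ofReal (c * Real.logb 2 n ^ 2) ≤
              (RadioNetwork.timeComplexity A L n : ENNReal)) := by
  refine ⟨1 / 32768, by norm_num, ⟨2 ^ 128, fun n hn A L hL hA =>
    RadioNetwork.logb_sq_le_timeComplexity hn A L hL hA⟩, fun C => ?_⟩
  obtain ⟨N, hN⟩ := RadioNetwork.exists_forall_loglog_lt C
  refine ⟨max N (2 ^ 128), fun A L hL hA n hn => RadioNetwork.logb_sq_le_timeComplexity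
    ((le_max_right _ _).trans hn) A L (fun k hk G hG => ?_) (hA n)⟩
  exact (hL k G hG).trans_lt (hN n ((le_max_left _ _).trans hn) _
    ((RadioNetwork.maxDeg_lt hG).trans_le hk))
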